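/- Call a pair of integers $x,y$ with $x^2+3xy+y^2=M$ a solution; it is primitive if $\gcd(x,y)=1$, and positive if $x\ge 0$ and $y\ge 0$. Solutions are counted as unordered pairs $\{x,y\}$, i.e. $(x,y)$ and $(y,x)$ are the same solution. Primes of $\mathbb{Z}$ are allowed to be negative. (1) Let $M>1$ be an integer of the form $M = 5^r\prod_{l=1}^{n} p_l^{k_l}$, where $r\in\{0,1\}$, $n\ge 0$, all $k_l\ge 1$, and $p_1,\dots,p_n\in\mathbb{Z}$ are primes with pairwise different absolute values such that $p_l\equiv 1$ or $p_l\equiv -1 \pmod 5$ for every $l$. Then the equation $x^2+3xy+y^2=M$ has exactly $\lceil 2^{n-1}\rceil$ positive, primitive solutions (that is, $2^{n-1}$ if $n\ge1$, and $1$ if $n=0$). (2) Let $M>1$ be an integer which is divisible by a positive prime $q\ne 5$ with $q\not\equiv \pm1\pmod 5$, or which is divisible by $25$. Then the equation $x^2+3xy+y^2=M$ has no primitive solution $x,y\in\mathbb{Z}$ at all (positive or not). -/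

import Mathlib

/-- `(x, y)` is an integer solution of `x² + z x y + y² = M`. -/
def IsQuadSolution (z M x y : ℤ) : Prop :=
  x ^ 2 + z * x * y + y ^ 2 = M

/-- A solution is primitive if its two entries are coprime. -/
def IsPrimitiveQuadSolution (z M x y : ℤ) : Prop :=
  IsQuadSolution z M x y ∧ IsCoprime x y

/-- The positive (meaning that both entries are nonnegative), primitive solutions of
`x² + z x y + y² = M`. A solution is an unordered pair `{x, y}`: interchanging `x` and `y`
gives the same solution. -/
def positivePrimitiveSolutions (z M : ℤ) : Set (Sym2 ℤ) :=
  {s | ∃ x y : ℤ, s = s(x, y) ∧ 0 ≤ x ∧ 0 ≤ y ∧ IsPrimitiveQuadSolution z M x y}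

/-!
Write `f(x, y) = x² + 3xy + y²`; this is the norm of `x + yω`, where `ω² = 3ω - 1`, so `f` is the
norm form of the ring of integers of `ℚ(√5)` and `ω` is a unit of norm `1`.

For `M > 1` the map `(x, y) ↦ x / y` is a bijection from the *ordered* primitive solutions of
`f(x, y) = M` with `x, y ≥ 0` to the roots of `t² + 3t + 1` in `ℤ/M` (`bijOn_ratio`).

* Surjectivity rests on the fact that the ring has class number one and a unit of norm `-1`. Both
  enter through a descent on `|M|` (`exists_form_eq_of_dvd`): a root `t` modulo `M`, chosen of least
  size, satisfies `t² + 3t + 1 = M M'` with `|M'| < |M|`, and dividing `t + ω` by an element of norm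
  `M'` leaves an element of norm `M` that belongs to the root `t`. Multiplication by powers of `ω`
  then moves this element to the quadrant `x, y ≥ 0` (`exists_nonneg_of_form_eq`).
* Injectivity says that this quadrant contains only one element of each orbit of the
  norm `1` units (`eq_of_nonneg_of_dvd`).

The number of roots is multiplicative by the Chinese remainder theorem. It equals `1` modulo `5` and,
by quadratic reciprocity and Hensel lifting, `2` modulo a power of a prime `p ≡ ±1 (mod 5)`. So
there are `2ⁿ` ordered solutions. Swapping the entries has no fixed point unless `M = 5`, which gives
the count of unordered solutions. The nonexistence statement is reciprocity again, together with
`f(x, y) = (x - y)² + 5xy` for the divisor `25`.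
-/

/-! ### Representing `M` by a solution attached to a given root -/

/-- Each root `t` of `t² + 3t + 1` modulo `M ≠ 0` comes from a representation of `M` by the form:
every ideal of norm `|M|` with cyclic quotient has a generator of norm `M`, whatever the sign. -/
lemma exists_form_eq_of_dvd (N : ℕ) : ∀ (M t : ℤ), M.natAbs = N → M ≠ 0 → M ∣ t ^ 2 + 3 * t + 1 →
    ∃ x y : ℤ, x ^ 2 + 3 * x * y + y ^ 2 = M ∧ M ∣ x - t * y := by
  induction N using Nat.strong_induction_on with
  | _ N ih =>
    intro M t hN hM hdvd
    by_cases h1 : M = 1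
    · exact ⟨1, 0, by rw [h1]; norm_num, by rw [h1]; exact one_dvd _⟩
    by_cases h2 : M = -1
    · -- `-1 + ω` is a unit of norm `-1`.
      exact ⟨-1, 1, by rw [h2]; norm_num, by rw [h2]; exact isUnit_one.neg.dvd⟩
    -- Replace `t` by a representative `s` with `|2s + 3| ≤ |M|`.
    obtain ⟨s, hs, hlo, hhi⟩ : ∃ s : ℤ, M ∣ s - t ∧ -|M| ≤ 2 * s + 3 ∧ 2 * s + 3 ≤ |M| := by
      have hpos : 0 < |M| := abs_pos.mpr hM
      refine ⟨t - |M| * ((2 * t + 3 + |M|) / (2 * |M|)), ?_, ?_, ?_⟩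
      · have : M ∣ |M| := (dvd_abs M M).mpr dvd_rfl
        have h := (this.mul_right ((2 * t + 3 + |M|) / (2 * |M|))).neg_right
        exact h.trans (dvd_of_eq (by ring))
      · have := Int.mul_ediv_self_le (x := 2 * t + 3 + |M|) (k := 2 * |M|) (by omega)
        linarith
      · have := Int.lt_mul_ediv_self_add (x := 2 * t + 3 + |M|) (k := 2 * |M|) (by omega)
        linarith
    have hsd : M ∣ s ^ 2 + 3 * s + 1 := by
      have h := dvd_add hdvd (hs.mul_right (s + t + 3))
      exact h.trans (dvd_of_eq (by ring))
    obtain ⟨M', hM'⟩ := hsd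
    have hM'0 : M' ≠ 0 := by
      -- The discriminant `5` is not a square.
      rintro rfl
      have h5 : (2 * s + 3) ^ 2 = 5 := by linarith
      have hl : 2 * s + 3 < 3 := by nlinarith
      have hr : -3 < 2 * s + 3 := by nlinarith
      have : s = -2 ∨ s = -1 := by omega
      rcases this with rfl | rfl <;> norm_num at h5
    have habs2 : 2 ≤ |M| := by
      have := abs_pos.mpr hM
      rcases abs_cases M with h | h <;> omega
    have hlt : M'.natAbs < N := by
      rw [← hN, ← Int.ofNat_lt, Int.natCast_natAbs, Int.natCast_natAbs]
      have hsq : (2 * s + 3) ^ 2 ≤ |M| ^ 2 := sq_le_sq' hlo hhi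
      have hprod : |M| * |M'| = |s ^ 2 + 3 * s + 1| := by rw [hM', abs_mul]
      have hbound : |s ^ 2 + 3 * s + 1| < |M| ^ 2 := by
        rw [abs_lt]
        constructor <;> nlinarith [sq_nonneg (2 * s + 3)]
      nlinarith
    obtain ⟨a, b, hab, y, hy⟩ := ih _ hlt M' s rfl hM'0 ⟨M, by rw [hM']; ring⟩
    -- `x + yω` is the quotient of `s + ω` by `a + bω`.
    refine ⟨s * y + M * b, y, ?_, ?_⟩
    · have ha : a = s * b + M' * y := by linarith
      apply mul_left_cancel₀ hM'0
      rw [ha] at hab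
      linear_combination M * hab + (M' * y ^ 2 - M * b ^ 2) * hM'
    · have h := dvd_add (hs.mul_right y) (dvd_mul_right M b)
      exact h.trans (dvd_of_eq (by ring))

/-- Multiplication by `±ω` and `±ω⁻¹` moves an element of positive norm to the quadrant
`x, y ≥ 0` without changing its norm or the root it belongs to. -/
lemma exists_nonneg_of_form_eq {M t : ℤ} (hM : 0 < M) (ht : M ∣ t ^ 2 + 3 * t + 1) (N : ℕ) :
    ∀ x y : ℤ, x.natAbs + y.natAbs = N → x ^ 2 + 3 * x * y + y ^ 2 = M → M ∣ x - t * y →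
      ∃ u v : ℤ, 0 ≤ u ∧ 0 ≤ v ∧ u ^ 2 + 3 * u * v + v ^ 2 = M ∧ M ∣ u - t * v := by
  induction N using Nat.strong_induction_on with
  | _ N ih =>
    have step : ∀ x y : ℤ, x.natAbs + y.natAbs = N → x ^ 2 + 3 * x * y + y ^ 2 = M →
        M ∣ x - t * y → 0 < x → y < 0 →
        ∃ u v : ℤ, 0 ≤ u ∧ 0 ≤ v ∧ u ^ 2 + 3 * u * v + v ^ 2 = M ∧ M ∣ u - t * v := by
      intro x y hN hf hd hx hy
      rcases le_or_gt (-y) x with h | h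
      · -- Multiply by `ω`, which sends `(x, y)` to `(-y, x + 3y)`.
        have h2 : -(2 * y) < x := by nlinarith
        refine ih _ ?_ (-y) (x + 3 * y) rfl (by rw [← hf]; ring) ?_
        · omega
        · have h := dvd_sub (hd.mul_right (-t)) (ht.mul_right y)
          exact h.trans (dvd_of_eq (by ring))
      · -- Multiply by `ω⁻¹ = 3 - ω`, which sends `(x, y)` to `(3x + y, -x)`.
        have h2 : 2 * x < -y := by nlinarith
        refine ih _ ?_ (3 * x + y) (-x) rfl (by rw [← hf]; ring) ?_
        · omega
        · have h := dvd_sub (hd.mul_right (3 + t)) (ht.mul_right (-y))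
          exact h.trans (dvd_of_eq (by ring))
    intro x y hN hf hd
    have hd' : M ∣ -x - t * -y := hd.neg_right.trans (dvd_of_eq (by ring))
    have hf' : (-x) ^ 2 + 3 * (-x) * (-y) + (-y) ^ 2 = M := by rw [← hf]; ring
    rcases le_or_gt 0 x with hx | hx <;> rcases le_or_gt 0 y with hy | hy
    · exact ⟨x, y, hx, hy, hf, hd⟩
    · rcases hx.eq_or_lt with rfl | hx
      · exact ⟨-0, -y, by simp, by omega, hf', hd'⟩
      · exact step x y hN hf hd hx hy
    · rcases hy.eq_or_lt with rfl | hy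
      · exact ⟨-x, -0, by omega, by simp, hf', hd'⟩
      · exact step (-x) (-y) (by omega) hf' hd' (by omega) (by omega)
    · exact ⟨-x, -y, by omega, by omega, hf', hd'⟩

/-- A solution belonging to a root modulo the full `M` is primitive: a common factor `d` of `x` and
`y` would give a value of the form that equals `M / d²` and is divisible by `M / d`. -/
lemma isCoprime_of_form_eq_of_dvd {M t x y : ℤ} (hM : 0 < M) (ht : M ∣ t ^ 2 + 3 * t + 1)
    (hf : x ^ 2 + 3 * x * y + y ^ 2 = M) (hd : M ∣ x - t * y) : IsCoprime x y := by
  rw [Int.isCoprime_iff_gcd_eq_one]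
  have hg0 : (x.gcd y : ℤ) ≠ 0 := by
    intro h
    have h' : x.gcd y = 0 := by exact_mod_cast h
    rw [Int.gcd_eq_zero_iff] at h'
    rw [h'.1, h'.2] at hf
    norm_num at hf
    omega
  obtain ⟨a, ha⟩ := Int.gcd_dvd_left x y
  obtain ⟨b, hb⟩ := Int.gcd_dvd_right x y
  generalize hg : (x.gcd y : ℤ) = g at *
  obtain ⟨c, hc⟩ := hd
  obtain ⟨e, he⟩ := ht
  have hM' : g * (g * (a ^ 2 + 3 * a * b + b ^ 2)) = M := by rw [← hf, ha, hb]; ring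
  have hab : a - t * b = g * (a ^ 2 + 3 * a * b + b ^ 2) * c := by
    apply mul_left_cancel₀ hg0
    rw [ha, hb] at hc
    linear_combination hc - c * hM'
  have hF0 : a ^ 2 + 3 * a * b + b ^ 2 ≠ 0 := by
    intro h; rw [h] at hM'; simp at hM'; omega
  have hunit : g ∣ 1 := by
    generalize hF : a ^ 2 + 3 * a * b + b ^ 2 = F at *
    refine ⟨c * (a + t * b + 3 * b) + g * e * b ^ 2, ?_⟩
    apply mul_left_cancel₀ hF0
    linear_combination -hF + (a + t * b + 3 * b) * hab + b ^ 2 * he - e * b ^ 2 * hM'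
  have : (x.gcd y : ℤ) ∣ 1 := hg ▸ hunit
  exact_mod_cast Int.eq_one_of_dvd_one (by positivity) this

/-- Two primitive solutions with nonnegative entries that belong to the same root coincide. The
quotient of `x + yω` by `x' + y'ω` is `(a + bω) / M` with `a = xx' + 3xy' + yy'`, `b = yx' - xy'`
and `a² + 3ab + b² = M²`; here `M ∣ b` and `a ≥ 0`, and
`b ≥ 0` by symmetry. So `b ≥ M` would force `a = 0`, which coprimality excludes for `M > 1`. -/
lemma eq_of_nonneg_of_dvd {M x y x' y' : ℤ} (hM : 1 < M) (hx : 0 ≤ x) (hy : 0 ≤ y)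
    (hx' : 0 ≤ x') (hy' : 0 ≤ y') (hf : x ^ 2 + 3 * x * y + y ^ 2 = M)
    (hf' : x' ^ 2 + 3 * x' * y' + y' ^ 2 = M) (hc : IsCoprime x y) (hc' : IsCoprime x' y')
    (hd : M ∣ y * x' - x * y') : x = x' ∧ y = y' := by
  have key : ∀ x y x' y' : ℤ, 0 ≤ x → 0 ≤ y → 0 ≤ x' → 0 ≤ y' →
      x ^ 2 + 3 * x * y + y ^ 2 = M → x' ^ 2 + 3 * x' * y' + y' ^ 2 = M → IsCoprime x y →
      M ∣ y * x' - x * y' → 0 ≤ y * x' - x * y' → y * x' = x * y' := by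
    intro x y x' y' hx hy hx' hy' hf hf' hc hd hb
    by_contra hne
    have hle : M ≤ y * x' - x * y' := Int.le_of_dvd (by omega) hd
    have hnorm : (x * x' + 3 * x * y' + y * y') ^ 2 +
        3 * (x * x' + 3 * x * y' + y * y') * (y * x' - x * y') + (y * x' - x * y') ^ 2 = M * M := by
      nth_rewrite 1 [← hf]; rw [← hf']; ring
    have h1 := mul_nonneg hx hx'
    have h2 := mul_nonneg hx hy'
    have h3 := mul_nonneg hy hy'
    have ha0 : x * x' + 3 * x * y' + y * y' = 0 := by nlinarith
    have hxx : x * x' = 0 := by linarith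
    have hxy : x * y' = 0 := by linarith
    have hx0 : x = 0 := by
      rcases mul_eq_zero.mp hxx with h | h
      · exact h
      · rw [h] at hle; omega
    subst hx0
    have hy1 : y = 1 := by
      have := Int.isUnit_iff.mp (isCoprime_zero_left.mp hc)
      omega
    subst hy1
    omega
  have hxy : y * x' = x * y' := by
    rcases le_total 0 (y * x' - x * y') with h | h
    · exact key x y x' y' hx hy hx' hy' hf hf' hc hd h
    · have hd' : M ∣ y' * x - x' * y := hd.neg_right.trans (dvd_of_eq (by ring))
      linarith [key x' y' x y hx' hy' hx hy hf' hf hc' hd' (by linarith)]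
  have hxx : x = x' := by
    refine Int.dvd_antisymm hx hx' ?_ ?_
    · exact hc.dvd_of_dvd_mul_left (hxy ▸ dvd_mul_right x y')
    · exact hc'.dvd_of_dvd_mul_right (hxy ▸ dvd_mul_left x' y)
  have hyy : y = y' := by
    refine Int.dvd_antisymm hy hy' ?_ ?_
    · exact hc.symm.dvd_of_dvd_mul_left (hxy ▸ dvd_mul_right y x')
    · exact hc'.symm.dvd_of_dvd_mul_right (hxy ▸ dvd_mul_left y' x)
  exact ⟨hxx, hyy⟩

/-! ### Ordered solutions and roots modulo `M` -/

/-- The primitive solutions of `x² + 3xy + y² = M` with nonnegative entries, as ordered pairs. -/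
def orderedSolutions (M : ℤ) : Set (ℤ × ℤ) :=
  {s | 0 ≤ s.1 ∧ 0 ≤ s.2 ∧ s.1 ^ 2 + 3 * s.1 * s.2 + s.2 ^ 2 = M ∧ IsCoprime s.1 s.2}

/-- The roots of `t² + 3t + 1` in `ℤ/M`. -/
def quadRoots (M : ℕ) : Set (ZMod M) :=
  {t | t ^ 2 + 3 * t + 1 = 0}

lemma isUnit_intCast_of_form_eq {M : ℕ} {x y : ℤ} (hf : x ^ 2 + 3 * x * y + y ^ 2 = M)
    (hc : IsCoprime x y) : IsUnit (y : ZMod M) := by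
  have h : IsCoprime (M : ℤ) y := by
    have h2 : IsCoprime (x ^ 2 + (3 * x + y) * y) y := (hc.pow_left (m := 2)).add_mul_right_left _
    rw [← hf]
    convert h2 using 1; ring
  obtain ⟨a, b, hab⟩ := h
  refine IsUnit.of_mul_eq_one (b : ZMod M) ?_
  have := congrArg (Int.cast : ℤ → ZMod M) hab
  push_cast at this
  rw [ZMod.natCast_self] at this
  linear_combination this

/-- The root `x / y` modulo `M` determines an ordered solution, and every root occurs. -/
lemma bijOn_ratio {M : ℕ} (hM : 1 < M) :
    Set.BijOn (fun s : ℤ × ℤ => (s.1 : ZMod M) * (s.2 : ZMod M)⁻¹)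
      (orderedSolutions M) (quadRoots M) := by
  refine ⟨?_, ?_, ?_⟩
  · rintro ⟨x, y⟩ ⟨-, -, hf, hc⟩
    have hu := ZMod.mul_inv_of_unit _ (isUnit_intCast_of_form_eq hf hc)
    have hf' := congrArg (Int.cast : ℤ → ZMod M) hf
    push_cast at hf'
    rw [ZMod.natCast_self] at hf'
    simp only [quadRoots, Set.mem_ofPred_eq] at hu hf' ⊢
    generalize (y : ZMod M)⁻¹ = z at *
    linear_combination z ^ 2 * hf' - (3 * x * z + (y : ZMod M) * z + 1) * hu
  · rintro ⟨x, y⟩ ⟨hx, hy, hf, hc⟩ ⟨x', y'⟩ ⟨hx', hy', hf', hc'⟩ h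
    have hu := ZMod.mul_inv_of_unit _ (isUnit_intCast_of_form_eq hf hc)
    have hu' := ZMod.mul_inv_of_unit _ (isUnit_intCast_of_form_eq hf' hc')
    have hd : (M : ℤ) ∣ y * x' - x * y' := by
      rw [← ZMod.intCast_zmod_eq_zero_iff_dvd]
      push_cast
      simp only at h hu hu'
      linear_combination (-(y : ZMod M) * x') * hu' - (y : ZMod M) * y' * h + (x : ZMod M) * y' * hu
    obtain ⟨h1, h2⟩ := eq_of_nonneg_of_dvd (by exact_mod_cast hM) hx hy hx' hy' hf hf' hc hc' hd
    exact Prod.ext h1 h2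
  · intro t ht
    have hM0 : (0 : ℤ) < M := by exact_mod_cast (by omega : 0 < M)
    obtain ⟨t, rfl⟩ := ZMod.intCast_surjective t
    have ht' : (M : ℤ) ∣ t ^ 2 + 3 * t + 1 := by
      rw [← ZMod.intCast_zmod_eq_zero_iff_dvd]
      push_cast
      exact ht
    obtain ⟨x, y, hf, hd⟩ := exists_form_eq_of_dvd _ M t rfl hM0.ne' ht'
    obtain ⟨u, v, hu, hv, hf, hd⟩ := exists_nonneg_of_form_eq hM0 ht' _ x y rfl hf hd
    have hc := isCoprime_of_form_eq_of_dvd hM0 ht' hf hd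
    refine ⟨(u, v), ⟨hu, hv, hf, hc⟩, ?_⟩
    have hi := ZMod.mul_inv_of_unit _ (isUnit_intCast_of_form_eq hf hc)
    rw [← ZMod.intCast_zmod_eq_zero_iff_dvd] at hd
    push_cast at hd
    simp only
    linear_combination (v : ZMod M)⁻¹ * hd + t * hi

/-! ### Counting roots -/

lemma ncard_quadRoots_mul {a b : ℕ} (h : a.Coprime b) :
    (quadRoots (a * b)).ncard = (quadRoots a).ncard * (quadRoots b).ncard := by
  rw [← Set.ncard_prod]
  let e := ZMod.chineseRemainder h
  have himg : e '' quadRoots (a * b) = quadRoots a ×ˢ quadRoots b := by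
    ext ⟨u, v⟩
    rw [← EquivLike.coe_coe e, Equiv.image_eq_preimage_symm]
    change (e.symm (u, v)) ^ 2 + 3 * e.symm (u, v) + 1 = 0 ↔ u ^ 2 + 3 * u + 1 = 0 ∧
      v ^ 2 + 3 * v + 1 = 0
    rw [← map_eq_zero_iff e e.injective]
    simp only [map_add, map_mul, map_pow, map_one, map_ofNat, RingEquiv.apply_symm_apply]
    exact Prod.ext_iff
  rw [← himg, Set.ncard_image_of_injective _ e.injective]

lemma isSquare_zmod_five_iff : ∀ u : ZMod 5, IsSquare u ↔ u = 0 ∨ u = 1 ∨ u = -1 := by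
  decide

/-- By quadratic reciprocity, the discriminant `5` is a square modulo `p ≡ ±1 (mod 5)`, and the
root extends to every power of `p` by Hensel's lemma. -/
lemma exists_pow_dvd {p : ℕ} (hp : p.Prime) (h5 : (p : ℤ) ≡ 1 [ZMOD 5] ∨ (p : ℤ) ≡ -1 [ZMOD 5])
    (k : ℕ) : ∃ s : ℤ, (p : ℤ) ^ k ∣ s ^ 2 + 3 * s + 1 := by
  have hpf : Fact p.Prime := ⟨hp⟩
  have hp5 : p ≠ 5 := by rintro rfl; revert h5; decide
  have hp2 : p ≠ 2 := by rintro rfl; revert h5; decide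
  have hpz : Prime (p : ℤ) := Nat.prime_iff_prime_int.mp hp
  have hndvd : ¬ (p : ℤ) ∣ 5 := by
    intro h
    exact hp5 ((Nat.prime_dvd_prime_iff_eq hp Nat.prime_five).mp (by exact_mod_cast h))
  induction k with
  | zero => exact ⟨0, by simp⟩
  | succ k ih =>
    rcases k.eq_zero_or_pos with rfl | hk
    · have hsq : IsSquare ((5 : ℕ) : ZMod p) := by
        have : Fact (Nat.Prime 5) := ⟨Nat.prime_five⟩
        rw [← ZMod.exists_sq_eq_prime_iff_of_mod_four_eq_one (p := 5) (q := p) (by norm_num) hp2]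
        rcases h5 with h | h
        · replace h := (ZMod.intCast_eq_intCast_iff _ _ 5).mpr h
          push_cast at h; rw [isSquare_zmod_five_iff, h]; simp
        · replace h := (ZMod.intCast_eq_intCast_iff _ _ 5).mpr h
          push_cast at h; rw [isSquare_zmod_five_iff, h]; simp
      obtain ⟨c, hc⟩ := hsq
      have h2 : (2 : ZMod p) ≠ 0 := by
        intro h
        have : p ∣ 2 := (ZMod.natCast_eq_zero_iff 2 p).mp (by exact_mod_cast h)
        exact hp2 ((Nat.prime_dvd_prime_iff_eq hp Nat.prime_two).mp this)
      obtain ⟨s, hs⟩ := ZMod.intCast_surjective ((c - 3) / 2)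
      refine ⟨s, ?_⟩
      rw [zero_add, pow_one, ← ZMod.intCast_zmod_eq_zero_iff_dvd]
      push_cast at hc ⊢
      rw [hs]
      field_simp
      linear_combination -hc
    · obtain ⟨s, m, hm⟩ := ih
      have hnd : ¬ (p : ℤ) ∣ 2 * s + 3 := by
        intro h
        have h1 : (p : ℤ) ∣ s ^ 2 + 3 * s + 1 := (dvd_pow_self _ hk.ne').trans ⟨m, hm⟩
        refine hndvd ?_
        have := dvd_sub (h.mul_right (2 * s + 3)) (h1.mul_right 4)
        exact this.trans (dvd_of_eq (by ring))
      obtain ⟨a, b, hab⟩ := (hpz.coprime_iff_not_dvd.mpr hnd)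
      -- Correct `s` by the Newton step: `b` is the inverse of the derivative `2s + 3` modulo `p`.
      refine ⟨s + p ^ k * (-(m * b)), ?_⟩
      have h1 : (p : ℤ) ^ (k + 1) ∣ p ^ k * (p * (m * a)) := ⟨m * a, by ring⟩
      have h2 : (p : ℤ) ^ (k + 1) ∣ p ^ k * p ^ k * (m * b) ^ 2 := by
        rw [← pow_add]; exact (pow_dvd_pow _ (by omega)).mul_right _
      have h := dvd_add h1 h2
      refine h.trans (dvd_of_eq ?_)
      linear_combination -hm + p ^ k * m * hab

lemma ncard_quadRoots_prime_pow {p : ℕ} (hp : p.Prime)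
    (h5 : (p : ℤ) ≡ 1 [ZMOD 5] ∨ (p : ℤ) ≡ -1 [ZMOD 5]) {k : ℕ} (hk : 0 < k) :
    (quadRoots (p ^ k)).ncard = 2 := by
  have hp5 : p ≠ 5 := by rintro rfl; revert h5; decide
  have hpz : Prime (p : ℤ) := Nat.prime_iff_prime_int.mp hp
  have hndvd : ¬ (p : ℤ) ∣ 5 := by
    intro h
    exact hp5 ((Nat.prime_dvd_prime_iff_eq hp Nat.prime_five).mp (by exact_mod_cast h))
  obtain ⟨s, hs⟩ := exists_pow_dvd hp h5 k
  have hps : (p : ℤ) ∣ s ^ 2 + 3 * s + 1 := (dvd_pow_self _ hk.ne').trans hs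
  have hnd : ¬ (p : ℤ) ∣ 2 * s + 3 := by
    intro h
    refine hndvd ?_
    have := dvd_sub (h.mul_right (2 * s + 3)) (hps.mul_right 4)
    exact this.trans (dvd_of_eq (by ring))
  have hcast : ∀ z : ℤ, (z : ZMod (p ^ k)) = 0 ↔ (p : ℤ) ^ k ∣ z := by
    intro z
    rw [ZMod.intCast_zmod_eq_zero_iff_dvd]; push_cast; rfl
  have hs0 := (hcast _).mpr hs
  push_cast at hs0
  rw [Set.ncard_eq_two]
  refine ⟨(s : ZMod (p ^ k)), ((-3 - s : ℤ) : ZMod (p ^ k)), ?_, ?_⟩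
  · intro h
    rw [← sub_eq_zero, ← Int.cast_sub, hcast] at h
    apply hnd
    exact ((dvd_pow_self _ hk.ne').trans h).trans (dvd_of_eq (by ring))
  · ext t
    obtain ⟨t, rfl⟩ := ZMod.intCast_surjective t
    simp only [quadRoots, Set.mem_ofPred_eq, Set.mem_insert_iff, Set.mem_singleton_iff]
    constructor
    · intro ht
      have ht' : (p : ℤ) ^ k ∣ (t - s) * (t + s + 3) := by
        rw [← hcast]; push_cast
        linear_combination ht - hs0
      -- `p` cannot divide both factors, as their difference is `2s + 3`.
      by_cases h : (p : ℤ) ∣ t - s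
      · left
        have h' : ¬ (p : ℤ) ∣ t + s + 3 := by
          intro h'
          apply hnd
          exact (dvd_sub h' h).trans (dvd_of_eq (by ring))
        have := ((hpz.coprime_iff_not_dvd.mpr h').pow_left (m := k)).dvd_of_dvd_mul_right ht'
        rw [← sub_eq_zero, ← Int.cast_sub, hcast]
        exact this
      · right
        have := ((hpz.coprime_iff_not_dvd.mpr h).pow_left (m := k)).dvd_of_dvd_mul_left ht'
        rw [← sub_eq_zero, ← Int.cast_sub, hcast]
        exact this.trans (dvd_of_eq (by ring))
    · rintro (h | h)
      · rw [h]; exact hs0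
      · rw [h]; push_cast; linear_combination hs0

lemma ncard_quadRoots_one : (quadRoots 1).ncard = 1 := by
  rw [Set.ncard_eq_one]
  exact ⟨0, Set.ext fun t => iff_of_true (Subsingleton.elim _ _) (Subsingleton.elim t 0)⟩

lemma ncard_quadRoots_five : (quadRoots 5).ncard = 1 := by
  rw [Set.ncard_eq_one]
  refine ⟨1, ?_⟩
  ext t
  simp only [quadRoots, Set.mem_ofPred_eq, Set.mem_singleton_iff]
  revert t
  decide

lemma ncard_quadRoots_prod {ι : Type*} (S : Finset ι) (r : ℕ) (hr : r = 0 ∨ r = 1)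
    (p k : ι → ℕ) (hp : ∀ i, (p i).Prime) (hinj : Function.Injective p) (hk : ∀ i, 0 < k i)
    (h5 : ∀ i, (p i : ℤ) ≡ 1 [ZMOD 5] ∨ (p i : ℤ) ≡ -1 [ZMOD 5]) :
    (quadRoots (5 ^ r * ∏ i ∈ S, p i ^ k i)).ncard = 2 ^ S.card := by
  classical
  induction S using Finset.induction_on with
  | empty =>
    rcases hr with rfl | rfl
    · simpa using ncard_quadRoots_one
    · simpa using ncard_quadRoots_five
  | insert i S hi ih =>
    have hcop : (p i ^ k i).Coprime (5 ^ r * ∏ j ∈ S, p j ^ k j) := by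
      refine Nat.Coprime.mul_right ?_ (Nat.Coprime.prod_right fun j hj => ?_)
      · refine Nat.Coprime.pow _ _ ((Nat.coprime_primes (hp i) Nat.prime_five).mpr ?_)
        intro h
        have := h5 i
        rw [h] at this
        revert this; decide
      · refine Nat.Coprime.pow _ _ ((Nat.coprime_primes (hp i) (hp j)).mpr fun h => ?_)
        exact hi (hinj h ▸ hj)
    rw [Finset.prod_insert hi, mul_left_comm, ncard_quadRoots_mul hcop, ih,
      ncard_quadRoots_prime_pow (hp i) (h5 i) (hk i), Finset.card_insert_of_notMem hi, pow_succ']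

/-! ### Unordered solutions -/

lemma positivePrimitiveSolutions_eq_image (M : ℤ) :
    positivePrimitiveSolutions 3 M = (fun s : ℤ × ℤ => s(s.1, s.2)) '' orderedSolutions M := by
  ext s
  constructor
  · rintro ⟨x, y, rfl, hx, hy, hf, hc⟩
    exact ⟨(x, y), ⟨hx, hy, hf, hc⟩, rfl⟩
  · rintro ⟨⟨x, y⟩, ⟨hx, hy, hf, hc⟩, rfl⟩
    exact ⟨x, y, rfl, hx, hy, hf, hc⟩

lemma eq_five_of_mem_orderedSolutions {M x : ℤ} (h : (x, x) ∈ orderedSolutions M) : M = 5 := by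
  obtain ⟨-, -, hf, hc⟩ := h
  have := Int.isUnit_iff.mp (isCoprime_self.mp hc)
  simp only at hf this
  rcases this with rfl | rfl <;> norm_num at hf <;> exact hf.symm

/-- Away from `M = 5` each unordered solution comes from exactly two ordered ones. -/
lemma ncard_orderedSolutions {M : ℤ} (hM : M ≠ 5) (hfin : (orderedSolutions M).Finite) :
    (orderedSolutions M).ncard = 2 * (positivePrimitiveSolutions 3 M).ncard := by
  have hswap : ∀ x y : ℤ, (x, y) ∈ orderedSolutions M → (y, x) ∈ orderedSolutions M := by
    rintro x y ⟨hx, hy, hf, hc⟩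
    exact ⟨hy, hx, by simp only at hf ⊢; rw [← hf]; ring, hc.symm⟩
  have hne : ∀ s ∈ orderedSolutions M, s.1 ≠ s.2 := by
    rintro ⟨x, y⟩ hs (rfl : x = y)
    exact hM (eq_five_of_mem_orderedSolutions hs)
  set L : Set (ℤ × ℤ) := {s ∈ orderedSolutions M | s.1 < s.2} with hL
  set G : Set (ℤ × ℤ) := {s ∈ orderedSolutions M | s.2 < s.1} with hG
  have hunion : orderedSolutions M = L ∪ G := by
    ext s
    constructor
    · intro hs
      exact (lt_or_gt_of_ne (hne s hs)).imp (⟨hs, ·⟩) (⟨hs, ·⟩)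
    · rintro (h | h) <;> exact h.1
  have hdisj : Disjoint L G := by
    rw [Set.disjoint_left]
    exact fun s h h' => lt_asymm h.2 h'.2
  have hGL : G = Prod.swap '' L := by
    ext ⟨x, y⟩
    constructor
    · rintro ⟨h, h'⟩
      exact ⟨(y, x), ⟨hswap _ _ h, h'⟩, rfl⟩
    · rintro ⟨⟨a, b⟩, ⟨h, h'⟩, hab⟩
      obtain ⟨rfl, rfl⟩ := Prod.ext_iff.mp hab
      exact ⟨hswap _ _ h, h'⟩
  have himg : positivePrimitiveSolutions 3 M = (fun s : ℤ × ℤ => s(s.1, s.2)) '' L := by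
    rw [positivePrimitiveSolutions_eq_image]
    refine Set.Subset.antisymm ?_ (Set.image_mono fun s hs => hs.1)
    rintro _ ⟨⟨x, y⟩, hs, rfl⟩
    rcases lt_or_gt_of_ne (hne _ hs) with h | h
    · exact ⟨(x, y), ⟨hs, h⟩, rfl⟩
    · exact ⟨(y, x), ⟨hswap _ _ hs, h⟩, Sym2.eq_swap⟩
  have hinj : Set.InjOn (fun s : ℤ × ℤ => s(s.1, s.2)) L := by
    rintro ⟨x, y⟩ ⟨-, h⟩ ⟨x', y'⟩ ⟨-, h'⟩ heq
    simp only [Sym2.eq_iff] at heq h h'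
    rcases heq with ⟨rfl, rfl⟩ | ⟨rfl, rfl⟩
    · rfl
    · exact absurd h (lt_asymm h')
  rw [himg, hinj.ncard_image, hunion, Set.ncard_union_eq hdisj (hfin.subset fun s hs => hs.1)
    (hfin.subset fun s hs => hs.1), hGL, Set.ncard_image_of_injective _ Prod.swap_injective, two_mul]

/-! ### Obstructions to primitive solutions -/

/-- The form equals `(x - y)² + 5xy`, so divisibility by `25` forces `5 ∣ x - y`, hence `5 ∣ xy`. -/
lemma not_isCoprime_of_twentyFive_dvd {x y : ℤ} (h : (25 : ℤ) ∣ x ^ 2 + 3 * x * y + y ^ 2) :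
    ¬ IsCoprime x y := by
  intro hc
  have hp : Prime (5 : ℤ) := by norm_num
  have h1 : (5 : ℤ) ∣ x - y := by
    refine hp.dvd_of_dvd_pow (n := 2) ?_
    have := dvd_sub ((by norm_num : (5 : ℤ) ∣ 25).trans h) (dvd_mul_right 5 (x * y))
    exact this.trans (dvd_of_eq (by ring))
  obtain ⟨c, hc'⟩ := h1
  obtain ⟨d, hd⟩ := h
  have h2 : (5 : ℤ) ∣ x * y := ⟨d - c ^ 2, by
    have : x = y + 5 * c := by linarith
    subst this
    linarith⟩
  have hx : (5 : ℤ) ∣ x ∧ (5 : ℤ) ∣ y := by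
    rcases hp.dvd_or_dvd h2 with h | h <;> omega
  exact hp.not_isUnit (hc.isUnit_of_dvd' hx.1 hx.2)

/-- A prime dividing a primitive value of the form has `5` as a quadratic residue, since
`4 f(x, y) = (2x + 3y)² - 5y²`; reciprocity turns this into a congruence modulo `5`. -/
lemma modEq_of_dvd_form {q : ℕ} (hq : q.Prime) (hq5 : q ≠ 5) {x y : ℤ} (hc : IsCoprime x y)
    (h : (q : ℤ) ∣ x ^ 2 + 3 * x * y + y ^ 2) :
    (q : ℤ) ≡ 1 [ZMOD 5] ∨ (q : ℤ) ≡ -1 [ZMOD 5] := by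
  have hqf : Fact q.Prime := ⟨hq⟩
  have hqz : Prime (q : ℤ) := Nat.prime_iff_prime_int.mp hq
  have hy : ¬ (q : ℤ) ∣ y := by
    intro hy
    have hx : (q : ℤ) ∣ x := by
      refine hqz.dvd_of_dvd_pow (n := 2) ?_
      have := dvd_sub h (hy.mul_right (3 * x + y))
      exact this.trans (dvd_of_eq (by ring))
    exact hqz.not_isUnit (hc.isUnit_of_dvd' hx hy)
  have hq2 : q ≠ 2 := by
    rintro rfl
    have hy' : y % 2 = 1 := by push_cast at hy; omega
    obtain ⟨b, rfl⟩ : ∃ b, y = 2 * b + 1 := ⟨y / 2, by omega⟩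
    obtain ⟨a, rfl | rfl⟩ : ∃ a, x = 2 * a ∨ x = 2 * a + 1 := ⟨x / 2, by omega⟩ <;>
    · ring_nf at h
      omega
  have hy0 : (y : ZMod q) ≠ 0 := by
    rwa [Ne, ZMod.intCast_zmod_eq_zero_iff_dvd]
  rw [← ZMod.intCast_zmod_eq_zero_iff_dvd] at h
  push_cast at h
  have hsq : IsSquare ((5 : ℕ) : ZMod q) := by
    refine ⟨(2 * x + 3 * y) / y, ?_⟩
    push_cast
    field_simp
    linear_combination -4 * h
  have : Fact (Nat.Prime 5) := ⟨Nat.prime_five⟩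
  rw [← ZMod.exists_sq_eq_prime_iff_of_mod_four_eq_one (p := 5) (q := q) (by norm_num) hq2] at hsq
  have hq0 : ((q : ℕ) : ZMod 5) ≠ 0 := by
    rw [Ne, ZMod.natCast_eq_zero_iff]
    exact fun h => hq5 ((Nat.prime_dvd_prime_iff_eq Nat.prime_five hq).mp h).symm
  refine Or.imp (ZMod.intCast_eq_intCast_iff _ _ 5).mp (ZMod.intCast_eq_intCast_iff _ _ 5).mp ?_
  push_cast
  exact ((isSquare_zmod_five_iff _).mp hsq).resolve_left hq0

theorem mainTheorem9 :
    (∀ (M r n : ℕ) (p : Fin n → ℤ) (k : Fin n → ℕ),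
      1 < M →
      (r = 0 ∨ r = 1) →
      (∀ l, Prime (p l)) →
      (∀ l, p l ≡ 1 [ZMOD 5] ∨ p l ≡ -1 [ZMOD 5]) →
      (∀ i j, i ≠ j → |p i| ≠ |p j|) →
      (∀ l, 0 < k l) →
      (M : ℤ) = 5 ^ r * ∏ l, p l ^ k l →
      (positivePrimitiveSolutions 3 M).Finite ∧
      ((positivePrimitiveSolutions 3 M).ncard : ℤ) = ⌈(2 : ℝ) ^ ((n : ℤ) - 1)⌉) ∧
    (∀ M : ℕ,
      1 < M →
      ((∃ q : ℕ, q.Prime ∧ q ∣ M ∧ q ≠ 5 ∧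
          ¬ ((q : ℤ) ≡ 1 [ZMOD 5] ∨ (q : ℤ) ≡ -1 [ZMOD 5])) ∨
        5 ^ 2 ∣ M) →
      ¬ ∃ x y : ℤ, IsPrimitiveQuadSolution 3 M x y) := by
  refine ⟨?_, ?_⟩
  · intro M r n p k hM hr hp h5 hne hk hprod
    have hMeq : M = 5 ^ r * ∏ l, (p l).natAbs ^ k l := by
      have := congrArg Int.natAbs hprod
      rw [Int.natAbs_natCast, Int.natAbs_mul, Int.natAbs_pow, ← Int.natAbsHom_apply (∏ l, _),
        map_prod] at this
      simpa [Int.natAbs_pow] using this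
    have hcount : (quadRoots M).ncard = 2 ^ n := by
      rw [hMeq]
      have := ncard_quadRoots_prod Finset.univ r hr (fun l => (p l).natAbs) k
        (fun l => Int.prime_iff_natAbs_prime.mp (hp l)) ?_ hk ?_
      · simpa using this
      · intro i j hij
        by_contra h
        exact hne i j h (by rw [Int.abs_eq_natAbs, Int.abs_eq_natAbs]; exact_mod_cast hij)
      · intro l
        have h := h5 l
        simp only [Int.ModEq] at h ⊢
        omega
    have hbij := bijOn_ratio hM
    have : NeZero M := ⟨by omega⟩
    have hfin : (orderedSolutions M).Finite := hbij.finite_iff_finite.mpr (Set.toFinite _)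
    have hord : (orderedSolutions M).ncard = 2 ^ n := by
      rw [← hcount, ← hbij.image_eq, hbij.injOn.ncard_image]
    refine ⟨?_, ?_⟩
    · rw [positivePrimitiveSolutions_eq_image]
      exact hfin.image _
    rcases n with _ | n
    · have h1 : (positivePrimitiveSolutions 3 M).ncard = 1 := by
        obtain ⟨s, hs⟩ := Set.ncard_eq_one.mp hord
        rw [positivePrimitiveSolutions_eq_image, hs, Set.image_singleton, Set.ncard_singleton]
      rw [h1, eq_comm, Int.ceil_eq_iff]
      norm_num
    · have hM5 : (M : ℤ) ≠ 5 := by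
        intro h
        have h' : M = 5 := by exact_mod_cast h
        rw [h', ncard_quadRoots_five, pow_succ] at hcount
        omega
      have h2 : (positivePrimitiveSolutions 3 M).ncard = 2 ^ n := by
        have := ncard_orderedSolutions hM5 hfin
        rw [hord, pow_succ] at this
        omega
      rw [h2]
      have : (2 : ℝ) ^ (((n + 1 : ℕ) : ℤ) - 1) = ((2 ^ n : ℤ) : ℝ) := by
        push_cast
        rw [add_sub_cancel_right, zpow_natCast]
      rw [this, Int.ceil_intCast]
      push_cast
      rfl
  · rintro M - h ⟨x, y, hf, hc⟩
    rw [IsQuadSolution] at hf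
    rcases h with ⟨q, hq, hqM, hq5, hn⟩ | h
    · exact hn (modEq_of_dvd_form hq hq5 hc (by rw [hf]; exact_mod_cast hqM))
    · exact not_isCoprime_of_twentyFive_dvd (by rw [hf]; exact_mod_cast h) hc
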